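/- **Setting.** Let $M$ be a smooth $n$-dimensional manifold and $(E,\langle\cdot,\cdot\rangle,[\![\cdot,\cdot]\!],\rho)$ a Courant algebroid over $M$: a smooth vector bundle $E\to M$ of constant finite rank with a smooth fibrewise nondegenerate symmetric bilinear form $\langle\cdot,\cdot\rangle$, an $\mathbb R$-bilinear bracket $[\![\cdot,\cdot]\!]$ on $\Gamma(E)$ and a smooth vector bundle map $\rho:E\to TM$ such that, for all $e_1,e_2,e_3\in\Gamma(E)$, $$[\![e_1,[\![e_2,e_3]\!]]\!]=[\![[\![e_1,e_2]\!],e_3]\!]+[\![e_2,[\![e_1,e_3]\!]]\!],$$ $$\rho(e_1)\langle e_2,e_3\rangle=\langle[\![e_1,e_2]\!],e_3\rangle+\langle e_2,[\![e_1,e_3]\!]\rangle,\qquad [\![e_1,e_2]\!]+[\![e_2,e_1]\!]=d_E\langle e_1,e_2\rangle,$$ where $d_E:C^\infty(M)\to\Gamma(E)$ is defined by $\langle d_Ef,e\rangle=\rho(e)(f)$; it is $\rho^*\circ d$ with $E^*\cong E$ identified by the metric. Let $(B,d_B,\langle\!\langle\cdot,\cdot\rangle\!\rangle)$ be a predual of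 $E$: a smooth vector bundle $B\to M$ of constant finite rank, a smooth fibrewise bilinear pairing $\langle\!\langle\cdot,\cdot\rangle\!\rangle:E\times_MB\to\mathbb R$ and a map $d_B:C^\infty(M)\to\Gamma(B)$ with $\langle\!\langle e,d_Bf\rangle\!\rangle=\rho(e)(f)$. Let $\nabla$ be an $E$-Dorfman connection on $B$, i.e. an $\mathbb R$-bilinear map $\nabla:\Gamma(E)\times\Gamma(B)\to\Gamma(B)$ such that, for $f\in C^\infty(M)$, $e\in\Gamma(E)$, $b\in\Gamma(B)$, $$\nabla_{fe}b=f\nabla_eb+\langle\!\langle e,b\rangle\!\rangle\, d_Bf,\qquad \nabla_e(fb)=f\nabla_eb+\rho(e)(f)\,b,\qquad \nabla_e(d_Bf)=d_B(\rho(e)(f)).$$ **Cochains.** Let $V=\Gamma(W)$, where $W$ is $B$ or $\mathrm{End}(B)$. A $V$-valued $p$-cochain is a tuple $\Phi=(\Phi_0,\dots,\Phi_{[p/2]})$ in which $\Phi_k$ assigns an element of $V$ to $p-2k$ sections of $E$ and $k$ functions. For $m\ge 1$, it belongs to $\mathfrak D^p_{m,m-1}(E;W)$ if $\Phi_k(e_1,\dots,e_{p-2k};f_1,\dots,f_k)=\bar\Phi_k(e_1,\dots,e_{p-2k};df_1,\dots,df_k)$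 for some $\mathbb R$-multilinear maps $\bar\Phi_k$ on $\Gamma(E)^{p-2k}\times\Omega^1(M)^k$, symmetric in the one-forms, satisfying $$\bar\Phi_k(\dots,e_i,e_{i+1},\dots;\alpha_1,\dots,\alpha_k)+\bar\Phi_k(\dots,e_{i+1},e_i,\dots;\alpha_1,\dots,\alpha_k)=-\bar\Phi_{k+1}(\dots,\hat e_i,\hat e_{i+1},\dots;d\langle e_i,e_{i+1}\rangle,\alpha_1,\dots,\alpha_k),$$ which are differential operators of order at most $m$ in each one-form and in each section of $E$, and of order at most $m-1$ in the last section of $E$ (for $p=1$ the only section counts as a first one, with bound $m$). Given $D:\Gamma(E)\times V\to V$, the covariant derivative of a $p$-cochain $\Phi$ is the $(p+1)$-cochain $$\begin{aligned}(d^{D}\Phi)_k(e_1,\dots,e_{p+1-2k};f_1,\dots,f_k)=&\sum_{\mu=1}^k\Phi_{k-1}(d_Ef_\mu,e_1,\dots,e_{p+1-2k};f_1,\dots,\hat f_\mu,\dots,f_k)\\&+\sum_{i}(-1)^{i-1}D_{e_i}\big(\Phi_k(e_1,\dots,\hat e_i,\dots,e_{p+1-2k};f_1,\dots,f_k)\big)\\&+\sum_{i<j}(-1)^i\Phi_k(e_1,\dots,\hat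 e_i,\dots,\hat e_j,[\![e_i,e_j]\!],e_{j+1},\dots,e_{p+1-2k};f_1,\dots,f_k).\end{aligned}$$ **Curvature and induced connection.** The curvature of $\nabla$ is $R^\nabla=(d^\nabla)^2$, viewed as a $\Gamma(\mathrm{End}(B))$-valued $2$-cochain $R^\nabla=(R^\nabla_0,R^\nabla_1)$: its value on given arguments is the $C^\infty(M)$-linear endomorphism $b\mapsto (d^\nabla(d^\nabla b))(\dots)$ of $\Gamma(B)$. Explicitly, $$R^\nabla_0(e_1,e_2)=\nabla_{e_1}\nabla_{e_2}-\nabla_{e_2}\nabla_{e_1}-\nabla_{[\![e_1,e_2]\!]},\qquad R^\nabla_1(f)=\nabla_{d_Ef}.$$ The connection induced by $\nabla$ on $\mathrm{End}(B)\cong B^*\otimes B$ is $\widetilde\nabla_e\tau=\nabla_e\circ\tau-\tau\circ\nabla_e$; equivalently $\widetilde\nabla_e(\beta\otimes b)=\nabla^*_e\beta\otimes b+\beta\otimes\nabla_eb$, where $\langle\nabla^*_e\beta,b\rangle=\rho(e)\langle\beta,b\rangle-\langle\beta,\nabla_eb\rangle$. **Proposition (Bianchi identity).** The curvature $R^\nabla$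 belongs to $\mathfrak D^2_{2,1}(E;\mathrm{End}(B))$, and $$d^{\widetilde\nabla}(R^\nabla)=0,$$ that is, both components of this $3$-cochain vanish: $(d^{\widetilde\nabla}R^\nabla)_0(e_1,e_2,e_3)=0$ and $(d^{\widetilde\nabla}R^\nabla)_1(e;f)=0$ for all $e,e_1,e_2,e_3\in\Gamma(E)$ and $f\in C^\infty(M)$. -/

import Mathlib

open scoped Manifold ContDiff Bundle Topology
open Bundle

set_option linter.unusedSectionVars false

noncomputable section

/-! ## Smooth functions, sections and one-forms -/

/-- The ring `C^∞(M)` of smooth real functions on an `n`-dimensional manifold `M`. -/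
abbrev SmoothFun (n : ℕ) (M : Type*) [TopologicalSpace M]
    [ChartedSpace (EuclideanSpace ℝ (Fin n)) M] : Type _ := C^∞⟮𝓡 n, M; ℝ⟯

/-- The space `Γ(E)` of smooth sections of a bundle `E → M` with model fibre `F`. -/
abbrev SmoothSection (n : ℕ) {M : Type*} [TopologicalSpace M]
    [ChartedSpace (EuclideanSpace ℝ (Fin n)) M]
    (F : Type*) [NormedAddCommGroup F] [NormedSpace ℝ F]
    (E : M → Type*) [TopologicalSpace (TotalSpace F E)] [∀ x, TopologicalSpace (E x)]
    [FiberBundle F E] : Type _ := Cₛ^∞⟮𝓡 n; F, E⟯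

/-- The space `Ω¹(M)` of smooth one-forms, i.e. smooth sections of the cotangent bundle. -/
abbrev OneForm (n : ℕ) (M : Type*) [TopologicalSpace M]
    [ChartedSpace (EuclideanSpace ℝ (Fin n)) M] [IsManifold (𝓡 n) ∞ M] : Type _ :=
  SmoothSection n (EuclideanSpace ℝ (Fin n) →L[ℝ] ℝ)
    (fun x : M => TangentSpace (𝓡 n) x →L[ℝ] ℝ)

section Sections

variable {n : ℕ} {M : Type*} [TopologicalSpace M] [ChartedSpace (EuclideanSpace ℝ (Fin n)) M]
  {F : Type*} [NormedAddCommGroup F] [NormedSpace ℝ F]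
  {E : M → Type*} [TopologicalSpace (TotalSpace F E)] [∀ x, TopologicalSpace (E x)]
  [∀ x, AddCommGroup (E x)] [∀ x, Module ℝ (E x)] [FiberBundle F E] [VectorBundle ℝ F E]

instance SmoothSection.instSMulFun : SMul (SmoothFun n M) (SmoothSection n F E) :=
  ⟨fun f s => ⟨fun x => f x • s x, f.contMDiff.smul_section s.contMDiff⟩⟩

@[simp] theorem SmoothSection.fun_smul_apply (f : SmoothFun n M) (s : SmoothSection n F E) (x : M) :
    (f • s) x = f x • s x := rfl

/-- `Γ(E)` is a module over `C^∞(M)` by pointwise multiplication. -/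
instance SmoothSection.instModuleFun : Module (SmoothFun n M) (SmoothSection n F E) where
  one_smul s := by ext x; simp
  mul_smul f g s := by ext x; simp [mul_smul]
  smul_zero f := by ext x; simp
  smul_add f s t := by ext x; simp
  add_smul f g s := by ext x; simp [add_smul]
  zero_smul s := by ext x; simp

instance SmoothSection.instSMulCommClassFun :
    SMulCommClass (SmoothFun n M) ℝ (SmoothSection n F E) :=
  ⟨fun f c s => by ext x; exact smul_comm _ _ _⟩

/-- A vector in a fibre extends to a global smooth section. -/
theorem SmoothSection.exists_apply_eq [T2Space M] [IsManifold (𝓡 n) ∞ M]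
    [ContMDiffVectorBundle ∞ F E (𝓡 n)] (x : M) (v : E x) : ∃ s : SmoothSection n F E, s x = v := by
  obtain ⟨u, hu, hs⟩ := FiberBundle.exists_contMDiffOn_extend (k := ∞) (𝓡 n) F v
  obtain ⟨t, htu, ht, hxt⟩ := mem_nhds_iff.1 hu
  obtain ⟨ψ, -, hψ⟩ := (SmoothBumpFunction.nhds_basis_tsupport (I := 𝓡 n) x).mem_iff.1
    (ht.mem_nhds hxt)
  refine ⟨⟨(ψ : M → ℝ) • FiberBundle.extend F v, ?_⟩, ?_⟩
  · exact ContMDiffOn.smul_section_of_tsupport (u := t) ψ.contMDiff.contMDiffOn ht hψ (hs.mono htu)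
  · simp

variable [IsManifold (𝓡 n) ∞ M]

/-- The differential `df` of a smooth function. -/
def exteriorD (f : SmoothFun n M) : OneForm n M where
  toFun x := mfderiv (𝓡 n) 𝓘(ℝ, ℝ) f x
  contMDiff_toFun := by
    intro x₀
    rw [contMDiffAt_hom_bundle]
    refine ⟨contMDiffAt_id, ?_⟩
    have := ContMDiffAt.mfderiv_const (m := ∞) (f.contMDiff.contMDiffAt (x := x₀)) le_rfl
    refine this.congr_of_eventuallyEq (Filter.Eventually.of_forall fun x => ?_)
    ext v
    simp [inTangentCoordinates, ContinuousLinearMap.inCoordinates]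
    rfl

theorem exteriorD_mul (f g : SmoothFun n M) :
    exteriorD (f * g) = f • exteriorD g + g • exteriorD f := by
  ext x : 1
  exact ((f.contMDiff.mdifferentiableAt (by simp) : MDifferentiableAt (𝓡 n) 𝓘(ℝ, ℝ) f x)
    |>.hasMFDerivAt.mul (g.contMDiff.mdifferentiableAt (by simp)
      : MDifferentiableAt (𝓡 n) 𝓘(ℝ, ℝ) g x).hasMFDerivAt).mfderiv

theorem exteriorD_add (f g : SmoothFun n M) :
    exteriorD (f + g) = exteriorD f + exteriorD g := by
  ext x : 1
  exact ((f.contMDiff.mdifferentiableAt (by simp) : MDifferentiableAt (𝓡 n) 𝓘(ℝ, ℝ) f x)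
    |>.hasMFDerivAt.add (g.contMDiff.mdifferentiableAt (by simp)
      : MDifferentiableAt (𝓡 n) 𝓘(ℝ, ℝ) g x).hasMFDerivAt).mfderiv

end Sections

section HomBundles

variable {n : ℕ} {M : Type*} [TopologicalSpace M] [ChartedSpace (EuclideanSpace ℝ (Fin n)) M]
  {F₁ F₂ F₃ : Type*} [NormedAddCommGroup F₁] [NormedSpace ℝ F₁]
  [NormedAddCommGroup F₂] [NormedSpace ℝ F₂] [NormedAddCommGroup F₃] [NormedSpace ℝ F₃]
  {E₁ E₂ E₃ : M → Type*} [TopologicalSpace (TotalSpace F₁ E₁)] [∀ x, TopologicalSpace (E₁ x)]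
  [∀ x, AddCommGroup (E₁ x)] [∀ x, Module ℝ (E₁ x)] [FiberBundle F₁ E₁] [VectorBundle ℝ F₁ E₁]
  [TopologicalSpace (TotalSpace F₂ E₂)] [∀ x, TopologicalSpace (E₂ x)]
  [∀ x, AddCommGroup (E₂ x)] [∀ x, Module ℝ (E₂ x)] [FiberBundle F₂ E₂] [VectorBundle ℝ F₂ E₂]
  [TopologicalSpace (TotalSpace F₃ E₃)] [∀ x, TopologicalSpace (E₃ x)]
  [∀ x, AddCommGroup (E₃ x)] [∀ x, Module ℝ (E₃ x)] [FiberBundle F₃ E₃] [VectorBundle ℝ F₃ E₃]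

open ContinuousLinearMap in
theorem contMDiff_section_inverse_apply
    [∀ x, IsTopologicalAddGroup (E₂ x)] [∀ x, ContinuousSMul ℝ (E₂ x)] [CompleteSpace F₁]
    (φ : SmoothSection n (F₁ →L[ℝ] F₂) (fun x => E₁ x →L[ℝ] E₂ x))
    (hφ : ∀ x, (φ x).IsInvertible) (s : SmoothSection n F₂ E₂) :
    ContMDiff (𝓡 n) ((𝓡 n).prod 𝓘(ℝ, F₁)) ∞
      (fun x => TotalSpace.mk' F₁ x ((φ x).inverse (s x))) := by
  intro x₀
  refine ContMDiffAt.clm_apply_of_inCoordinates (b₁ := id) (b₂ := id)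
    (ϕ := fun x => (φ x).inverse) ?_ (s.contMDiff.contMDiffAt) contMDiffAt_id
  have h := ((contMDiffAt_hom_bundle _).1 (φ.contMDiff.contMDiffAt (x := x₀))).2
  have h2 : ContMDiffAt (𝓡 n) 𝓘(ℝ, F₂ →L[ℝ] F₁) ∞ (ContinuousLinearMap.inverse ∘
      (fun x => inCoordinates F₁ E₁ F₂ E₂ x₀ x x₀ x (φ x))) x₀ := by
    refine ContMDiffAt.comp x₀ ?_ h
    apply ContDiffAt.contMDiffAt
    apply IsInvertible.contDiffAt_map_inverse
    rw [inCoordinates_eq (FiberBundle.mem_baseSet_trivializationAt' x₀)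
      (FiberBundle.mem_baseSet_trivializationAt' x₀)]
    exact isInvertible_equiv.comp ((hφ x₀).comp isInvertible_equiv)
  refine h2.congr_of_eventuallyEq ?_
  filter_upwards [(trivializationAt F₁ E₁ x₀).open_baseSet.mem_nhds
    (FiberBundle.mem_baseSet_trivializationAt' x₀),
    (trivializationAt F₂ E₂ x₀).open_baseSet.mem_nhds
    (FiberBundle.mem_baseSet_trivializationAt' x₀)] with x hx hx'
  simp only [Function.comp_apply, id]
  rw [inCoordinates_eq hx hx', inCoordinates_eq hx' hx]
  simp only [inverse_equiv_comp, inverse_comp_equiv, ContinuousLinearEquiv.symm_symm]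
  rfl

open ContinuousLinearMap in
theorem contMDiff_section_comp
    [∀ x, IsTopologicalAddGroup (E₂ x)] [∀ x, ContinuousSMul ℝ (E₂ x)]
    [∀ x, IsTopologicalAddGroup (E₃ x)] [∀ x, ContinuousSMul ℝ (E₃ x)]
    (φ : SmoothSection n (F₁ →L[ℝ] F₂) (fun x => E₁ x →L[ℝ] E₂ x))
    (ψ : SmoothSection n (F₂ →L[ℝ] F₃) (fun x => E₂ x →L[ℝ] E₃ x)) :
    ContMDiff (𝓡 n) ((𝓡 n).prod 𝓘(ℝ, F₁ →L[ℝ] F₃)) ∞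
      (fun x => TotalSpace.mk' (F₁ →L[ℝ] F₃) (E := fun x => E₁ x →L[ℝ] E₃ x)
        x ((ψ x).comp (φ x))) := by
  intro x₀
  rw [contMDiffAt_hom_bundle]
  refine ⟨contMDiffAt_id, ?_⟩
  have h := ((contMDiffAt_hom_bundle _).1 (φ.contMDiff.contMDiffAt (x := x₀))).2
  have h2 := ((contMDiffAt_hom_bundle _).1 (ψ.contMDiff.contMDiffAt (x := x₀))).2
  refine (h2.clm_comp h).congr_of_eventuallyEq ?_
  filter_upwards [(trivializationAt F₂ E₂ x₀).open_baseSet.mem_nhds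
    (FiberBundle.mem_baseSet_trivializationAt' x₀)] with x hx'
  ext v
  simp [inCoordinates, hx']

theorem isInvertible_of_nondegenerate [FiniteDimensional ℝ F₁] (x : M)
    (g : E₁ x →L[ℝ] E₁ x →L[ℝ] ℝ) (hg : ∀ v, (∀ w, g v w = 0) → v = 0) :
    g.IsInvertible := by
  let e := (trivializationAt F₁ E₁ x).continuousLinearEquivAt ℝ x
    (FiberBundle.mem_baseSet_trivializationAt' x)
  let G : F₁ →ₗ[ℝ] (F₁ →L[ℝ] ℝ) :=
    { toFun := fun v => (g (e.symm v)).comp (e.symm : F₁ →L[ℝ] E₁ x)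
      map_add' := fun v w => by ext; simp
      map_smul' := fun c v => by ext; simp }
  have hinj : Function.Injective G := by
    rw [← LinearMap.ker_eq_bot, LinearMap.ker_eq_bot']
    intro v hv
    have : e.symm v = 0 := hg _ fun w => by
      have := DFunLike.congr_fun hv (e w)
      simpa [G] using this
    simpa using this
  have hdim : Module.finrank ℝ F₁ = Module.finrank ℝ (F₁ →L[ℝ] ℝ) := by
    rw [← (LinearMap.toContinuousLinearMap (𝕜 := ℝ) (E := F₁) (F' := ℝ)).finrank_eq]
    exact (Subspace.dual_finrank_eq (K := ℝ) (V := F₁)).symm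
  let G' := (LinearEquiv.ofInjectiveOfFinrankEq G hinj hdim).toContinuousLinearEquiv
  let A : (F₁ →L[ℝ] ℝ) ≃L[ℝ] (E₁ x →L[ℝ] ℝ) := e.symm.arrowCongr (ContinuousLinearEquiv.refl ℝ ℝ)
  refine ⟨(e.trans G').trans A, ?_⟩
  have hG : ∀ u, G' u = G u := fun u => rfl
  ext v w
  simp [A, hG, G]

/-- The function `x ↦ ⟨φ_x (s x), t x⟩` obtained from a smooth field `φ` of bilinear pairings. -/
def pairSections (φ : SmoothSection n (F₁ →L[ℝ] F₂ →L[ℝ] ℝ) (fun x => E₁ x →L[ℝ] E₂ x →L[ℝ] ℝ))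
    (s : SmoothSection n F₁ E₁) (t : SmoothSection n F₂ E₂) : SmoothFun n M :=
  ⟨fun x => φ x (s x) (t x), by
    have h : ContMDiff (𝓡 n) ((𝓡 n).prod 𝓘(ℝ)) ∞
        (fun m => TotalSpace.mk' ℝ (E := Bundle.Trivial M ℝ) m (φ m (s m) (t m))) :=
      ContMDiff.clm_bundle_apply₂ (F₁ := F₁) (F₂ := F₂) φ.contMDiff s.contMDiff t.contMDiff
    intro x
    have := h x
    simp only [contMDiffAt_totalSpace] at this
    exact this.2⟩

@[simp] theorem pairSections_apply
    (φ : SmoothSection n (F₁ →L[ℝ] F₂ →L[ℝ] ℝ) (fun x => E₁ x →L[ℝ] E₂ x →L[ℝ] ℝ))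
    (s : SmoothSection n F₁ E₁) (t : SmoothSection n F₂ E₂) (x : M) :
    pairSections φ s t x = φ x (s x) (t x) := rfl

/-- The function `x ↦ α_x (s x)` obtained from a smooth field `α` of linear forms. -/
def evalSection (α : SmoothSection n (F₁ →L[ℝ] ℝ) (fun x => E₁ x →L[ℝ] ℝ))
    (s : SmoothSection n F₁ E₁) : SmoothFun n M :=
  ⟨fun x => α x (s x), by
    have h : ContMDiff (𝓡 n) ((𝓡 n).prod 𝓘(ℝ)) ∞
        (fun m => TotalSpace.mk' ℝ (E := Bundle.Trivial M ℝ) m (α m (s m))) :=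
      ContMDiff.clm_bundle_apply (F₁ := F₁) α.contMDiff s.contMDiff
    intro x
    have := h x
    simp only [contMDiffAt_totalSpace] at this
    exact this.2⟩

@[simp] theorem evalSection_apply (α : SmoothSection n (F₁ →L[ℝ] ℝ) (fun x => E₁ x →L[ℝ] ℝ))
    (s : SmoothSection n F₁ E₁) (x : M) : evalSection α s x = α x (s x) := rfl

end HomBundles

/-! ## Courant algebroids -/

section Courant

variable (n : ℕ) {M : Type*} [TopologicalSpace M] [ChartedSpace (EuclideanSpace ℝ (Fin n)) M]
  [IsManifold (𝓡 n) ∞ M]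
  (FE : Type*) [NormedAddCommGroup FE] [NormedSpace ℝ FE] [FiniteDimensional ℝ FE]
  (E : M → Type*) [TopologicalSpace (TotalSpace FE E)] [∀ x, TopologicalSpace (E x)]
  [∀ x, AddCommGroup (E x)] [∀ x, Module ℝ (E x)] [FiberBundle FE E] [VectorBundle ℝ FE E]
  [ContMDiffVectorBundle ∞ FE E (𝓡 n)]

/-- A vector bundle `E → M` with a smooth fibrewise nondegenerate symmetric bilinear form and a
smooth vector bundle map `E → TM` (the anchor). -/
structure AnchoredMetricBundle where
  /-- The fibrewise bilinear form. -/
  metric : SmoothSection n (FE →L[ℝ] FE →L[ℝ] ℝ) (fun x : M => E x →L[ℝ] E x →L[ℝ] ℝ)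
  metric_symm : ∀ (x : M) (v w : E x), metric x v w = metric x w v
  metric_nondegenerate : ∀ (x : M) (v : E x), (∀ w, metric x v w = 0) → v = 0
  /-- The anchor. -/
  anchor : SmoothSection n (FE →L[ℝ] EuclideanSpace ℝ (Fin n))
    (fun x : M => E x →L[ℝ] TangentSpace (𝓡 n) x)

namespace AnchoredMetricBundle

variable {n FE E}
variable (A : AnchoredMetricBundle n FE E)

/-- The function `⟨e₁, e₂⟩`. -/
def inner (e₁ e₂ : SmoothSection n FE E) : SmoothFun n M := pairSections A.metric e₁ e₂

/-- The composite `α ∘ ρ`, a smooth section of the dual bundle of `E`. -/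
def pullForm (α : OneForm n M) : SmoothSection n (FE →L[ℝ] ℝ) (fun x : M => E x →L[ℝ] ℝ) :=
  ⟨fun x => (α x).comp (A.anchor x), contMDiff_section_comp A.anchor α⟩

/-- The function `ρ(e)(f)`. -/
def anchorDeriv (e : SmoothSection n FE E) (f : SmoothFun n M) : SmoothFun n M :=
  evalSection (A.pullForm (exteriorD f)) e

theorem metric_isInvertible (x : M) : (A.metric x).IsInvertible :=
  isInvertible_of_nondegenerate (F₁ := FE) (E₁ := E) x (A.metric x) (A.metric_nondegenerate x)

/-- The map `ρ* : Ω¹(M) → Γ(E)`, where the dual of `E` is identified with `E` by the metric. -/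
def rhoStar (α : OneForm n M) : SmoothSection n FE E :=
  haveI : CompleteSpace FE := FiniteDimensional.complete ℝ FE
  ⟨fun x => (A.metric x).inverse (A.pullForm α x),
    contMDiff_section_inverse_apply A.metric A.metric_isInvertible (A.pullForm α)⟩

/-- The map `d_E = ρ* ∘ d : C^∞(M) → Γ(E)`. -/
def dE (f : SmoothFun n M) : SmoothSection n FE E := A.rhoStar (exteriorD f)

theorem inner_rhoStar (α : OneForm n M) (e : SmoothSection n FE E) :
    A.inner (A.rhoStar α) e = evalSection (A.pullForm α) e := by
  ext x
  have := (A.metric_isInvertible x).self_apply_inverse (A.pullForm α x)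
  exact DFunLike.congr_fun this (e x)

/-- The defining property `⟨d_E f, e⟩ = ρ(e)(f)`. -/
theorem inner_dE (f : SmoothFun n M) (e : SmoothSection n FE E) :
    A.inner (A.dE f) e = A.anchorDeriv e f := A.inner_rhoStar _ _

theorem inner_comm (e₁ e₂ : SmoothSection n FE E) : A.inner e₁ e₂ = A.inner e₂ e₁ := by
  ext x; exact A.metric_symm x _ _

theorem inner_add_left (e₁ e₂ e₃ : SmoothSection n FE E) :
    A.inner (e₁ + e₂) e₃ = A.inner e₁ e₃ + A.inner e₂ e₃ := by
  ext x; simp [inner]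

theorem inner_smul_left (f : SmoothFun n M) (e₁ e₂ : SmoothSection n FE E) :
    A.inner (f • e₁) e₂ = f * A.inner e₁ e₂ := by
  ext x; simp [inner]

theorem inner_smul_right (f : SmoothFun n M) (e₁ e₂ : SmoothSection n FE E) :
    A.inner e₁ (f • e₂) = f * A.inner e₁ e₂ := by
  ext x; simp [inner]

theorem inner_sub_left (e₁ e₂ e₃ : SmoothSection n FE E) :
    A.inner (e₁ - e₂) e₃ = A.inner e₁ e₃ - A.inner e₂ e₃ := by
  ext x; simp [inner]

theorem anchorDeriv_mul (e : SmoothSection n FE E) (f g : SmoothFun n M) :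
    A.anchorDeriv e (f * g) = f * A.anchorDeriv e g + g * A.anchorDeriv e f := by
  ext x; simp [anchorDeriv, pullForm, exteriorD_mul]

theorem anchorDeriv_add (e : SmoothSection n FE E) (f g : SmoothFun n M) :
    A.anchorDeriv e (f + g) = A.anchorDeriv e f + A.anchorDeriv e g := by
  ext x; simp [anchorDeriv, pullForm, exteriorD_add]

theorem anchorDeriv_add_left (e₁ e₂ : SmoothSection n FE E) (f : SmoothFun n M) :
    A.anchorDeriv (e₁ + e₂) f = A.anchorDeriv e₁ f + A.anchorDeriv e₂ f := by
  ext x; simp [anchorDeriv]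

theorem anchorDeriv_smul_left (g : SmoothFun n M) (e : SmoothSection n FE E)
    (f : SmoothFun n M) : A.anchorDeriv (g • e) f = g * A.anchorDeriv e f := by
  ext x; simp [anchorDeriv]

theorem eq_of_inner_eq [T2Space M] {s t : SmoothSection n FE E}
    (h : ∀ e, A.inner s e = A.inner t e) : s = t := by
  ext x
  rw [← sub_eq_zero]
  refine A.metric_nondegenerate x _ fun w => ?_
  obtain ⟨e, rfl⟩ := SmoothSection.exists_apply_eq (n := n) (F := FE) x w
  have := DFunLike.congr_fun (h e) x
  simp only [inner, pairSections_apply] at this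
  simp [this]

theorem dE_mul [T2Space M] (f g : SmoothFun n M) :
    A.dE (f * g) = f • A.dE g + g • A.dE f := by
  refine A.eq_of_inner_eq fun e => ?_
  simp only [inner_add_left, inner_smul_left, inner_dE, anchorDeriv_mul]

end AnchoredMetricBundle

/-- A Courant algebroid over `M`, with its Courant-Dorfman bracket. -/
structure CourantAlgebroid extends AnchoredMetricBundle (M := M) n FE E where
  /-- The `ℝ`-bilinear Courant-Dorfman bracket on `Γ(E)`. -/
  bracket : SmoothSection n FE E →ₗ[ℝ] SmoothSection n FE E →ₗ[ℝ] SmoothSection n FE E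
  jacobi : ∀ e₁ e₂ e₃ : SmoothSection n FE E,
    bracket e₁ (bracket e₂ e₃) = bracket (bracket e₁ e₂) e₃ + bracket e₂ (bracket e₁ e₃)
  compat : ∀ e₁ e₂ e₃ : SmoothSection n FE E,
    toAnchoredMetricBundle.anchorDeriv e₁ (toAnchoredMetricBundle.inner e₂ e₃) =
      toAnchoredMetricBundle.inner (bracket e₁ e₂) e₃ +
        toAnchoredMetricBundle.inner e₂ (bracket e₁ e₃)
  bracket_add_bracket : ∀ e₁ e₂ : SmoothSection n FE E,
    bracket e₁ e₂ + bracket e₂ e₁ =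
      toAnchoredMetricBundle.dE (toAnchoredMetricBundle.inner e₁ e₂)

namespace CourantAlgebroid

variable {n FE E}
variable (C : CourantAlgebroid n FE E)

theorem smoothFun_eq_zero_of_mul_self {f : SmoothFun n M} (h : f * f = 0) : f = 0 := by
  ext x
  have := DFunLike.congr_fun h x
  exact mul_self_eq_zero.1 this

theorem bracket_smul_right [T2Space M] (e₁ e₂ : SmoothSection n FE E) (f : SmoothFun n M) :
    C.bracket e₁ (f • e₂) = f • C.bracket e₁ e₂ + C.anchorDeriv e₁ f • e₂ := by
  refine C.eq_of_inner_eq fun e => ?_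
  have h1 := C.compat e₁ (f • e₂) e
  have h2 := C.compat e₁ e₂ e
  rw [C.inner_smul_left, C.anchorDeriv_mul, h2, C.inner_smul_left] at h1
  rw [C.inner_add_left, C.inner_smul_left, C.inner_smul_left]
  linear_combination -h1

/-- The anchor is a morphism of brackets. -/
theorem anchorDeriv_bracket [T2Space M] (e₁ e₂ : SmoothSection n FE E) (f : SmoothFun n M) :
    C.anchorDeriv (C.bracket e₁ e₂) f =
      C.anchorDeriv e₁ (C.anchorDeriv e₂ f) - C.anchorDeriv e₂ (C.anchorDeriv e₁ f) := by
  have key : ∀ e₃ : SmoothSection n FE E, (C.anchorDeriv (C.bracket e₁ e₂) f - (C.anchorDeriv e₁ (C.anchorDeriv e₂ f)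
      - C.anchorDeriv e₂ (C.anchorDeriv e₁ f))) • e₃ = 0 := by
    intro e₃
    have h := C.jacobi e₁ e₂ (f • e₃)
    have h' := C.jacobi e₁ e₂ e₃
    simp only [C.bracket_smul_right, map_add] at h
    rw [h'] at h
    rw [← sub_eq_zero] at h
    rw [← neg_eq_zero, ← h]
    module
  have key' : ∀ (e₃ : SmoothSection n FE E) (g : SmoothFun n M), (C.anchorDeriv (C.bracket e₁ e₂) f - (C.anchorDeriv e₁ (C.anchorDeriv e₂ f)
      - C.anchorDeriv e₂ (C.anchorDeriv e₁ f))) * C.anchorDeriv e₃ g = 0 := by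
    intro e₃ g
    rw [← C.anchorDeriv_smul_left, key]
    ext x; simp [AnchoredMetricBundle.anchorDeriv]
  rw [← sub_eq_zero]
  apply smoothFun_eq_zero_of_mul_self
  linear_combination key' (C.bracket e₁ e₂) f - key' e₁ (C.anchorDeriv e₂ f)
    + key' e₂ (C.anchorDeriv e₁ f)

theorem anchorDeriv_dE [T2Space M] (f g : SmoothFun n M) : C.anchorDeriv (C.dE f) g = 0 := by
  have h1 : ∀ e₁ e₂, C.anchorDeriv (C.dE (C.inner e₁ e₂)) g = 0 := by
    intro e₁ e₂
    rw [← C.bracket_add_bracket, C.anchorDeriv_add_left, C.anchorDeriv_bracket,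
      C.anchorDeriv_bracket]
    ring
  have h2 : ∀ e₁ e₂, C.inner e₁ e₂ * C.anchorDeriv (C.dE f) g = 0 := by
    intro e₁ e₂
    have h := h1 (f • e₁) e₂
    rw [C.inner_smul_left, C.dE_mul, C.anchorDeriv_add_left, C.anchorDeriv_smul_left, h1,
      C.anchorDeriv_smul_left] at h
    simpa using h
  apply smoothFun_eq_zero_of_mul_self
  have := h2 (C.dE g) (C.dE f)
  rwa [C.inner_dE] at this

end CourantAlgebroid

end Courant

/-! ## Cochains and covariant derivatives -/

/-- A `p`-cochain `Φ = (Φ_0, …, Φ_{[p/2]})` with values in `V`: its component `Φ_k` has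
`q = p - 2k` arguments in `X` and `k` arguments in `Y`. -/
abbrev Cochain (X Y V : Type*) (p : ℕ) : Type _ :=
  ∀ q k : ℕ, q + 2 * k = p → (Fin q → X) → (Fin k → Y) → V

/-- The `0`-cochain determined by a value. -/
def Cochain.const {X Y V : Type*} (v : V) : Cochain X Y V 0 := fun _ _ _ _ _ => v

/-- Differential operators of order at most `s` between modules over a commutative ring:
order `0` means linearity over the ring, and `D` has order at most `s + 1` if every symbol
`x ↦ D (f x) - f D x` has order at most `s`. -/
def IsDiffOp (R : Type*) [CommRing R] {X V : Type*} [AddCommGroup X] [Module R X]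
    [AddCommGroup V] [Module R V] : ℕ → (X → V) → Prop
  | 0, D => ∀ (f : R) (x : X), D (f • x) = f • D x
  | s + 1, D => ∀ f : R, IsDiffOp R s (fun x => D (f • x) - f • D x)

section Differential

variable {n : ℕ} {M : Type*} [TopologicalSpace M] [ChartedSpace (EuclideanSpace ℝ (Fin n)) M]
  [IsManifold (𝓡 n) ∞ M]
  {FE : Type*} [NormedAddCommGroup FE] [NormedSpace ℝ FE] [FiniteDimensional ℝ FE]
  {E : M → Type*} [TopologicalSpace (TotalSpace FE E)] [∀ x, TopologicalSpace (E x)]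
  [∀ x, AddCommGroup (E x)] [∀ x, Module ℝ (E x)] [FiberBundle FE E] [VectorBundle ℝ FE E]
  [ContMDiffVectorBundle ∞ FE E (𝓡 n)]

namespace CourantAlgebroid

variable (C : CourantAlgebroid n FE E)
variable {V : Type*} [AddCommGroup V]

/-- `∑_μ Φ_{k-1}(d_E f_μ, e_1, …, e_q; f_1, …, f̂_μ, …, f_k)`. -/
def diffTermFun {p : ℕ} (Φ : Cochain (SmoothSection n FE E) (SmoothFun n M) V p) :
    Cochain (SmoothSection n FE E) (SmoothFun n M) V (p + 1)
  | _, 0, _, _, _ => 0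
  | q, k + 1, h, e, f =>
      ∑ μ : Fin (k + 1), Φ (q + 1) k (by omega) (Fin.cons (C.dE (f μ)) e) (μ.removeNth f)

/-- `∑_i (-1)^{i-1} ∇_{e_i} (Φ_k(e_1, …, ê_i, …, e_q; f_1, …, f_k))`, where the arguments are
numbered from `1`. -/
def diffTermNabla (nabla : SmoothSection n FE E → V → V) {p : ℕ}
    (Φ : Cochain (SmoothSection n FE E) (SmoothFun n M) V p) :
    Cochain (SmoothSection n FE E) (SmoothFun n M) V (p + 1)
  | 0, _, _, _, _ => 0
  | q + 1, k, h, e, f =>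
      ∑ i : Fin (q + 1), (-1 : ℤ) ^ (i : ℕ) •
        nabla (e i) (Φ q k (by omega) (i.removeNth e) f)

/-- `∑_{i<j} (-1)^i Φ_k(e_1, …, ê_i, …, ê_j, ⟦e_i, e_j⟧, e_{j+1}, …, e_q; f_1, …, f_k)`, where the
arguments are numbered from `1`. -/
def diffTermBracket {p : ℕ} (Φ : Cochain (SmoothSection n FE E) (SmoothFun n M) V p) :
    Cochain (SmoothSection n FE E) (SmoothFun n M) V (p + 1)
  | 0, _, _, _, _ => 0
  | q + 1, k, h, e, f =>
      ∑ i : Fin (q + 1), ∑ j : Fin (q + 1), if i < j then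
        (-1 : ℤ) ^ ((i : ℕ) + 1) •
          Φ q k (by omega) (i.removeNth (Function.update e j (C.bracket (e i) (e j)))) f
      else 0

/-- The covariant derivative `d^∇` on `V`-valued cochains determined by `∇ : Γ(E) × V → V`. -/
def covDiff (nabla : SmoothSection n FE E → V → V) {p : ℕ}
    (Φ : Cochain (SmoothSection n FE E) (SmoothFun n M) V p) :
    Cochain (SmoothSection n FE E) (SmoothFun n M) V (p + 1) :=
  fun q k h e f => C.diffTermFun Φ q k h e f + diffTermNabla nabla Φ q k h e f +
    C.diffTermBracket Φ q k h e f

/-- The conditions on a `p`-cochain of differential operators of type `(m, m - 1)`, in the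
realisation whose `Y`-arguments are one-forms. -/
structure IsDiffCochain [Module (SmoothFun n M) V] [Module ℝ V] (m : ℕ) {p : ℕ}
    (Φ : Cochain (SmoothSection n FE E) (OneForm n M) V p) : Prop where
  /-- `ℝ`-linearity in each argument from `Γ(E)` -/
  linear_section : ∀ q k (h : q + 2 * k = p) (e : Fin q → SmoothSection n FE E)
    (α : Fin k → OneForm n M) (i : Fin q),
    IsLinearMap ℝ fun s => Φ q k h (Function.update e i s) α
  /-- `ℝ`-linearity in each argument from `Ω¹(M)` -/
  linear_form : ∀ q k (h : q + 2 * k = p) (e : Fin q → SmoothSection n FE E)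
    (α : Fin k → OneForm n M) (μ : Fin k),
    IsLinearMap ℝ fun β => Φ q k h e (Function.update α μ β)
  /-- symmetry in the arguments from `Ω¹(M)` -/
  symm_form : ∀ q k (h : q + 2 * k = p) (e : Fin q → SmoothSection n FE E)
    (α : Fin k → OneForm n M) (σ : Equiv.Perm (Fin k)), Φ q k h e (α ∘ σ) = Φ q k h e α
  /-- `Φ_k(…, e_i, e_{i+1}, …; …) + Φ_k(…, e_{i+1}, e_i, …; …)
    = - Φ_{k+1}(…, ê_i, ê_{i+1}, …; d⟨e_i, e_{i+1}⟩, …)` -/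
  swap_section : ∀ q k (h : q + 2 + 2 * k = p) (e : Fin (q + 2) → SmoothSection n FE E)
    (α : Fin k → OneForm n M) (i : Fin (q + 1)),
    Φ (q + 2) k h e α + Φ (q + 2) k h (e ∘ Equiv.swap i.castSucc i.succ) α =
      - Φ q (k + 1) (by omega) (i.removeNth (i.succ.removeNth e))
          (Fin.cons (exteriorD (C.inner (e i.castSucc) (e i.succ))) α)
  /-- order at most `m` in each argument from `Ω¹(M)` -/
  order_form : ∀ q k (h : q + 2 * k = p) (e : Fin q → SmoothSection n FE E)
    (α : Fin k → OneForm n M) (μ : Fin k),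
    IsDiffOp (SmoothFun n M) m fun β => Φ q k h e (Function.update α μ β)
  /-- order at most `m` in each argument from `Γ(E)`, and at most `m - 1` in the last one; for
  `p = 1` the only argument counts as a first one, so that the bound is `m` -/
  order_section : ∀ q k (h : q + 2 * k = p) (e : Fin q → SmoothSection n FE E)
    (α : Fin k → OneForm n M) (i : Fin q),
    IsDiffOp (SmoothFun n M) (if (i : ℕ) + 1 = q ∧ p ≠ 1 then m - 1 else m)
      fun s => Φ q k h (Function.update e i s) α

/-- Membership in the space `𝔇^p_{m,m-1} ⊗ V` of cochains of differential operators, for a cochain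
given by its values on functions: `Φ_k(…; f_1, …, f_k) = Φ̄_k(…; df_1, …, df_k)` for a tuple `Φ̄`
of differential operators on sections and one-forms. -/
def MemDiffCochain [Module (SmoothFun n M) V] [Module ℝ V] (m : ℕ) {p : ℕ}
    (Φ : Cochain (SmoothSection n FE E) (SmoothFun n M) V p) : Prop :=
  ∃ Φ' : Cochain (SmoothSection n FE E) (OneForm n M) V p, C.IsDiffCochain m Φ' ∧
    ∀ q k (h : q + 2 * k = p) (e : Fin q → SmoothSection n FE E) (f : Fin k → SmoothFun n M),
      Φ q k h e f = Φ' q k h e (fun μ => exteriorD (f μ))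

section Values

variable (nabla : SmoothSection n FE E → V → V)

theorem covDiff_const (v : V) (h : 1 + 2 * 0 = 0 + 1) (e : Fin 1 → SmoothSection n FE E)
    (f : Fin 0 → SmoothFun n M) :
    C.covDiff nabla (Cochain.const v) 1 0 h e f = nabla (e 0) v := by
  simp [covDiff, diffTermFun, diffTermNabla, diffTermBracket, Cochain.const]

theorem covDiff_covDiff_const_zero (v : V) (h : 2 + 2 * 0 = 0 + 1 + 1)
    (e : Fin 2 → SmoothSection n FE E) (f : Fin 0 → SmoothFun n M) :
    C.covDiff nabla (C.covDiff nabla (Cochain.const v)) 2 0 h e f =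
      nabla (e 0) (nabla (e 1) v) - nabla (e 1) (nabla (e 0) v)
        - nabla (C.bracket (e 0) (e 1)) v := by
  rw [covDiff]
  simp [diffTermFun, diffTermNabla, diffTermBracket, Fin.sum_univ_two, covDiff_const,
    Fin.removeNth, sub_eq_add_neg]

theorem covDiff_covDiff_const_one (v : V) (h : 0 + 2 * 1 = 0 + 1 + 1)
    (e : Fin 0 → SmoothSection n FE E) (f : Fin 1 → SmoothFun n M) :
    C.covDiff nabla (C.covDiff nabla (Cochain.const v)) 0 1 h e f = nabla (C.dE (f 0)) v := by
  rw [covDiff]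
  simp [diffTermFun, diffTermNabla, diffTermBracket, covDiff_const]

end Values

end CourantAlgebroid

end Differential

/-! ## Preduals and Dorfman connections -/

section Dorfman

variable {n : ℕ} {M : Type*} [TopologicalSpace M] [ChartedSpace (EuclideanSpace ℝ (Fin n)) M]
  [IsManifold (𝓡 n) ∞ M]
  {FE : Type*} [NormedAddCommGroup FE] [NormedSpace ℝ FE] [FiniteDimensional ℝ FE]
  {E : M → Type*} [TopologicalSpace (TotalSpace FE E)] [∀ x, TopologicalSpace (E x)]
  [∀ x, AddCommGroup (E x)] [∀ x, Module ℝ (E x)] [FiberBundle FE E] [VectorBundle ℝ FE E]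
  [ContMDiffVectorBundle ∞ FE E (𝓡 n)]

/-- A predual `(B, d_B, ⟪·,·⟫)` of a Courant algebroid `E`: a vector bundle `B → M`, a smooth
fibrewise bilinear pairing of `E` with `B`, and a map `d_B : C^∞(M) → Γ(B)` with
`⟪e, d_B f⟫ = ρ(e)(f)`. -/
structure Predual (C : CourantAlgebroid n FE E)
    (FB : Type*) [NormedAddCommGroup FB] [NormedSpace ℝ FB] [FiniteDimensional ℝ FB]
    (B : M → Type*) [TopologicalSpace (TotalSpace FB B)] [∀ x, TopologicalSpace (B x)]
    [∀ x, AddCommGroup (B x)] [∀ x, Module ℝ (B x)] [FiberBundle FB B] [VectorBundle ℝ FB B]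
    [ContMDiffVectorBundle ∞ FB B (𝓡 n)] where
  /-- The fibrewise pairing of `E` with `B`. -/
  pairing : SmoothSection n (FE →L[ℝ] FB →L[ℝ] ℝ) (fun x : M => E x →L[ℝ] B x →L[ℝ] ℝ)
  /-- The map `d_B`. -/
  dB : SmoothFun n M → SmoothSection n FB B
  pairing_dB : ∀ (e : SmoothSection n FE E) (f : SmoothFun n M),
    pairSections pairing e (dB f) = C.anchorDeriv e f

variable {C : CourantAlgebroid n FE E}
  {FB : Type*} [NormedAddCommGroup FB] [NormedSpace ℝ FB] [FiniteDimensional ℝ FB]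
  {B : M → Type*} [TopologicalSpace (TotalSpace FB B)] [∀ x, TopologicalSpace (B x)]
  [∀ x, AddCommGroup (B x)] [∀ x, Module ℝ (B x)] [FiberBundle FB B] [VectorBundle ℝ FB B]
  [ContMDiffVectorBundle ∞ FB B (𝓡 n)]

/-- An `E`-Dorfman connection on a predual `B` of `E`. -/
structure DorfmanConnection (P : Predual C FB B) where
  /-- The `ℝ`-bilinear map `∇ : Γ(E) × Γ(B) → Γ(B)`. -/
  nabla : SmoothSection n FE E →ₗ[ℝ] SmoothSection n FB B →ₗ[ℝ] SmoothSection n FB B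
  nabla_smul_left : ∀ (f : SmoothFun n M) (e : SmoothSection n FE E) (b : SmoothSection n FB B),
    nabla (f • e) b = f • nabla e b + pairSections P.pairing e b • P.dB f
  nabla_smul_right : ∀ (f : SmoothFun n M) (e : SmoothSection n FE E) (b : SmoothSection n FB B),
    nabla e (f • b) = f • nabla e b + C.anchorDeriv e f • b
  nabla_dB : ∀ (e : SmoothSection n FE E) (f : SmoothFun n M),
    nabla e (P.dB f) = P.dB (C.anchorDeriv e f)

/-- `Γ(End B)`, as the `C^∞(M)`-linear endomorphisms of `Γ(B)`. -/
abbrev EndSection (n : ℕ) {M : Type*} [TopologicalSpace M]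
    [ChartedSpace (EuclideanSpace ℝ (Fin n)) M]
    (FB : Type*) [NormedAddCommGroup FB] [NormedSpace ℝ FB]
    (B : M → Type*) [TopologicalSpace (TotalSpace FB B)] [∀ x, TopologicalSpace (B x)]
    [∀ x, AddCommGroup (B x)] [∀ x, Module ℝ (B x)] [FiberBundle FB B]
    [VectorBundle ℝ FB B] : Type _ :=
  Module.End (SmoothFun n M) (SmoothSection n FB B)

namespace DorfmanConnection

variable {P : Predual C FB B} (N : DorfmanConnection P)

/-- The covariant derivative `d^∇` on `Γ(B)`-valued cochains. -/
def dNabla {p : ℕ}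
    (H : Cochain (SmoothSection n FE E) (SmoothFun n M) (SmoothSection n FB B) p) :
    Cochain (SmoothSection n FE E) (SmoothFun n M) (SmoothSection n FB B) (p + 1) :=
  C.covDiff (fun e b => N.nabla e b) H

/-- The dual connection `∇*` on `Γ(B*)`, determined by
`ρ(e)⟨β, b⟩ = ⟨∇*_e β, b⟩ + ⟨β, ∇_e b⟩`. -/
def dualNabla (e : SmoothSection n FE E)
    (β : Module.Dual (SmoothFun n M) (SmoothSection n FB B)) :
    Module.Dual (SmoothFun n M) (SmoothSection n FB B) where
  toFun b := C.anchorDeriv e (β b) - β (N.nabla e b)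
  map_add' b b' := by simp only [map_add, C.anchorDeriv_add]; ring
  map_smul' f b := by
    simp only [map_smul, map_add, N.nabla_smul_right, smul_eq_mul, C.anchorDeriv_mul,
      RingHom.id_apply]
    ring

/-- The induced connection `∇̃` on `End B`: `∇̃_e τ = ∇_e ∘ τ - τ ∘ ∇_e`. -/
def endNabla (e : SmoothSection n FE E) (τ : EndSection n FB B) : EndSection n FB B where
  toFun b := N.nabla e (τ b) - τ (N.nabla e b)
  map_add' b b' := by simp only [map_add]; abel
  map_smul' f b := by
    simp only [map_smul, map_add, N.nabla_smul_right, RingHom.id_apply]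
    module

/-- Under `B* ⊗ B ≅ End B` the induced connection is
`∇̃_e (β ⊗ b) = ∇*_e β ⊗ b + β ⊗ ∇_e b`. -/
theorem endNabla_smulRight (e : SmoothSection n FE E)
    (β : Module.Dual (SmoothFun n M) (SmoothSection n FB B)) (b : SmoothSection n FB B) :
    N.endNabla e (β.smulRight b) =
      (N.dualNabla e β).smulRight b + β.smulRight (N.nabla e b) := by
  ext1 b'
  simp only [endNabla, dualNabla, LinearMap.coe_mk, AddHom.coe_mk, LinearMap.smulRight_apply,
    LinearMap.add_apply, N.nabla_smul_right]
  module

/-- The covariant derivative `d^∇̃` on `Γ(End B)`-valued cochains. -/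
def dEndNabla {p : ℕ}
    (Φ : Cochain (SmoothSection n FE E) (SmoothFun n M) (EndSection n FB B) p) :
    Cochain (SmoothSection n FE E) (SmoothFun n M) (EndSection n FB B) (p + 1) :=
  C.covDiff N.endNabla Φ

theorem dNabla_dNabla_add (b b' : SmoothSection n FB B)
    (q k : ℕ) (h : q + 2 * k = 0 + 1 + 1) (e : Fin q → SmoothSection n FE E)
    (f : Fin k → SmoothFun n M) :
    N.dNabla (N.dNabla (Cochain.const (b + b'))) q k h e f =
      N.dNabla (N.dNabla (Cochain.const b)) q k h e f +
        N.dNabla (N.dNabla (Cochain.const b')) q k h e f := by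
  simp only [dNabla]
  obtain ⟨rfl, rfl⟩ | ⟨rfl, rfl⟩ : (q = 2 ∧ k = 0) ∨ (q = 0 ∧ k = 1) := by omega
  · simp only [C.covDiff_covDiff_const_zero, map_add]; abel
  · simp only [C.covDiff_covDiff_const_one, map_add]

theorem dNabla_dNabla_smul [T2Space M] (g : SmoothFun n M) (b : SmoothSection n FB B)
    (q k : ℕ) (h : q + 2 * k = 0 + 1 + 1) (e : Fin q → SmoothSection n FE E)
    (f : Fin k → SmoothFun n M) :
    N.dNabla (N.dNabla (Cochain.const (g • b))) q k h e f =
      g • N.dNabla (N.dNabla (Cochain.const b)) q k h e f := by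
  simp only [dNabla]
  obtain ⟨rfl, rfl⟩ | ⟨rfl, rfl⟩ : (q = 2 ∧ k = 0) ∨ (q = 0 ∧ k = 1) := by omega
  · simp only [C.covDiff_covDiff_const_zero, N.nabla_smul_right, map_add, C.anchorDeriv_bracket]
    module
  · simp only [C.covDiff_covDiff_const_one, N.nabla_smul_right, C.anchorDeriv_dE]
    simp

/-- The curvature `R^∇ = (d^∇)²`, as a `2`-cochain with values in `Γ(End B)`: its value on given
arguments is the endomorphism `b ↦ (d^∇ (d^∇ b))(…)`. -/
def curvature [T2Space M] :
    Cochain (SmoothSection n FE E) (SmoothFun n M) (EndSection n FB B) 2 :=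
  fun q k h e f =>
    { toFun := fun b => N.dNabla (N.dNabla (Cochain.const b)) q k h e f
      map_add' := fun b b' => N.dNabla_dNabla_add b b' q k h e f
      map_smul' := fun g b => N.dNabla_dNabla_smul g b q k h e f }

end DorfmanConnection

end Dorfman

end

/-! The identity has two halves, one per component of the 3-cochain. For three sections, the
covariant derivatives of the commutators cancel by associativity of composition, and the terms left
over are `∇` of nested brackets, which cancel by the Jacobi identity in Leibniz form; skew-symmetry
of the bracket is never needed (`bianchi_sections`). For one section and one function, everything
cancels except `∇` along the bracket of `d_E f` with `e`, and this bracket is zero (`bracket_dE`,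
`bianchi_function`).

Membership in the cochain space requires the function component to extend to one-forms. The
extension is `α ↦ ∇_{ρ*α}`, which is an endomorphism of `B` exactly because `ρ ∘ ρ* = 0` kills the
derivative term (`anchorDeriv_rhoStar`). The swap relation is the symmetric part of the bracket seen
through `∇`. The orders come from symbols: order 1 in the last section by direct expansion, and
order 2 in the first one by swapping the arguments and bounding the correction `∇_{d_E⟨s,e⟩}`. No
derivation rule for `d_B` is assumed; the weakened form `pairing_smul_dB_mul`, multiplied by a
pairing, is enough. -/

noncomputable section

/-! ### Smooth functions separate tangent vectors. -/

section TangentVectors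

variable {n : ℕ} {M : Type*} [TopologicalSpace M] [T2Space M]
  [ChartedSpace (EuclideanSpace ℝ (Fin n)) M] [IsManifold (𝓡 n) ∞ M]

/-- A tangent vector annihilated by the differentials of all smooth functions vanishes. -/
theorem tangentVector_eq_zero_of_exteriorD {x : M} {v : TangentSpace (𝓡 n) x}
    (h : ∀ g : SmoothFun n M, exteriorD g x v = 0) : v = 0 := by
  have hinv := isInvertible_mfderiv_extChartAt (I := 𝓡 n) (mem_extChartAt_source (I := 𝓡 n) x)
  refine hinv.injective ?_
  rw [map_zero]
  refine ext_inner_right ℝ fun w => ?_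
  obtain ⟨ψ⟩ : Nonempty (SmoothBumpFunction (𝓡 n) x) := inferInstance
  let L : EuclideanSpace ℝ (Fin n) →L[ℝ] ℝ := innerSL ℝ w
  have hc : ContMDiffOn (𝓡 n) 𝓘(ℝ, ℝ) ∞ (fun y => L (extChartAt (𝓡 n) x y))
      (chartAt (EuclideanSpace ℝ (Fin n)) x).source :=
    L.contMDiff.comp_contMDiffOn contMDiffOn_extChartAt
  -- The linear coordinate `⟨w, ·⟩` of the chart, cut off by a bump function: it is globally smooth
  -- and has the germ of the coordinate at `x`, so its differential reads off the `w`-component of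
  -- the image of `v`.
  let g : SmoothFun n M := ⟨_, ψ.contMDiff_smul hc⟩
  have hg : (g : M → ℝ) =ᶠ[𝓝 x] L ∘ extChartAt (𝓡 n) x := by
    filter_upwards [ψ.eventuallyEq_one] with y hy
    change ψ y • L (extChartAt (𝓡 n) x y) = _
    simp [hy]
  have hd := h g
  change mfderiv (𝓡 n) 𝓘(ℝ, ℝ) g x v = 0 at hd
  rw [hg.mfderiv_eq, mfderiv_comp x (I' := 𝓘(ℝ, EuclideanSpace ℝ (Fin n)))
    L.mdifferentiableAt (mdifferentiableAt_extChartAt (mem_chart_source _ x)),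
    L.mfderiv_eq] at hd
  rw [real_inner_comm, inner_zero_left]
  exact hd

end TangentVectors

/-! ### Consequences of the Courant algebroid axioms. -/

namespace CourantAlgebroid

variable {n : ℕ} {M : Type*} [TopologicalSpace M] [T2Space M]
  [ChartedSpace (EuclideanSpace ℝ (Fin n)) M] [IsManifold (𝓡 n) ∞ M]
  {FE : Type*} [NormedAddCommGroup FE] [NormedSpace ℝ FE] [FiniteDimensional ℝ FE]
  {E : M → Type*} [TopologicalSpace (TotalSpace FE E)] [∀ x, TopologicalSpace (E x)]
  [∀ x, AddCommGroup (E x)] [∀ x, Module ℝ (E x)] [FiberBundle FE E] [VectorBundle ℝ FE E]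
  [ContMDiffVectorBundle ∞ FE E (𝓡 n)]
  (C : CourantAlgebroid n FE E)

theorem anchor_dE (f : SmoothFun n M) (x : M) : C.anchor x (C.dE f x) = 0 :=
  tangentVector_eq_zero_of_exteriorD fun g => DFunLike.congr_fun (C.anchorDeriv_dE f g) x

/-- The composite `ρ ∘ ρ*` vanishes. -/
theorem anchorDeriv_rhoStar (α : OneForm n M) (f : SmoothFun n M) :
    C.anchorDeriv (C.rhoStar α) f = 0 := by
  -- Moving `ρ*` across the metric turns the claim for an arbitrary form `α` into `α` applied to
  -- `ρ(d_E f) = 0`, so `α` need not be exact.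
  rw [← C.inner_dE, C.inner_comm, C.inner_rhoStar]
  ext x
  change α x (C.anchor x (C.dE f x)) = 0
  rw [C.anchor_dE, map_zero]

/-- The right Leibniz rule carried to the left slot by the symmetric part of the bracket; the
derivation rule of `d_E` produces the last term. -/
theorem bracket_smul_left (f : SmoothFun n M) (e₁ e₂ : SmoothSection n FE E) :
    C.bracket (f • e₁) e₂ =
      f • C.bracket e₁ e₂ - C.anchorDeriv e₂ f • e₁ + C.inner e₁ e₂ • C.dE f := by
  have h₁ := C.bracket_add_bracket (f • e₁) e₂
  have h₂ := C.bracket_add_bracket e₁ e₂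
  rw [C.inner_smul_left, C.dE_mul, ← h₂, C.bracket_smul_right] at h₁
  rw [eq_sub_of_add_eq h₁]
  module

/-- Adding the Jacobi identity to its copy with `e₁` and `e₂` exchanged shows that the symmetric
part of the bracket acts as zero from the left, and that symmetric part is `d_E⟨e₁, e₂⟩`. -/
theorem bracket_dE_inner (e₁ e₂ e₃ : SmoothSection n FE E) :
    C.bracket (C.dE (C.inner e₁ e₂)) e₃ = 0 := by
  rw [← C.bracket_add_bracket, map_add, LinearMap.add_apply]
  have h₁ := C.jacobi e₁ e₂ e₃
  rw [C.jacobi e₂ e₁ e₃] at h₁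
  rw [← sub_eq_zero] at h₁
  rw [← neg_eq_zero, ← h₁]
  abel

/-- An arbitrary `f` need not be of the form `⟨e₁, e₂⟩`, so `bracket_dE_inner` is applied to `⟨f e₁,
e₂⟩ = f⟨e₁, e₂⟩`. The Leibniz corrections cancel in pairs, leaving the desired bracket multiplied by
any value of the metric. -/
theorem bracket_dE (f : SmoothFun n M) (e : SmoothSection n FE E) :
    C.bracket (C.dE f) e = 0 := by
  have key : ∀ e₁ e₂, C.inner e₁ e₂ • C.bracket (C.dE f) e = 0 := by
    intro e₁ e₂
    have h := C.bracket_dE_inner (f • e₁) e₂ e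
    rw [C.inner_smul_left, C.dE_mul, map_add, LinearMap.add_apply, C.bracket_smul_left,
      C.bracket_smul_left, C.bracket_dE_inner, C.inner_dE, C.inner_dE] at h
    rw [← h]
    module
  refine C.eq_of_inner_eq fun e' => ?_
  have h₀ : C.inner 0 e' = 0 := by ext x; simp [AnchoredMetricBundle.inner]
  rw [h₀]
  -- The function to be killed is itself a metric value, so it can serve as the factor in `key`; its
  -- square then vanishes.
  apply smoothFun_eq_zero_of_mul_self
  rw [← C.inner_smul_left, key, h₀]

theorem rhoStar_add (α β : OneForm n M) :
    C.rhoStar (α + β) = C.rhoStar α + C.rhoStar β := by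
  refine C.eq_of_inner_eq fun e => ?_
  simp only [C.inner_add_left, C.inner_rhoStar]
  ext x
  simp [AnchoredMetricBundle.pullForm]

theorem rhoStar_fun_smul (f : SmoothFun n M) (α : OneForm n M) :
    C.rhoStar (f • α) = f • C.rhoStar α := by
  refine C.eq_of_inner_eq fun e => ?_
  simp only [C.inner_smul_left, C.inner_rhoStar]
  ext x
  simp [AnchoredMetricBundle.pullForm]

theorem rhoStar_smul (c : ℝ) (α : OneForm n M) : C.rhoStar (c • α) = c • C.rhoStar α := by
  refine C.eq_of_inner_eq fun e => ?_
  ext x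
  have h₁ := DFunLike.congr_fun (C.inner_rhoStar (c • α) e) x
  have h₂ := DFunLike.congr_fun (C.inner_rhoStar α e) x
  rw [h₁]
  simp only [AnchoredMetricBundle.inner, pairSections_apply, evalSection_apply,
    ContMDiffSection.coe_smul, Pi.smul_apply, map_smul, smul_apply] at h₂ ⊢
  rw [h₂]
  simp [AnchoredMetricBundle.pullForm]

end CourantAlgebroid

/-! ### Closure properties of differential operators. -/

section IsDiffOp

variable {R X V : Type*} [CommRing R] [AddCommGroup X] [Module R X] [AddCommGroup V] [Module R V]

theorem IsDiffOp.succ {s : ℕ} {D : X → V} (h : IsDiffOp R s D) : IsDiffOp R (s + 1) D := by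
  induction s generalizing D with
  | zero =>
    intro f g x
    have h' : ∀ (f : R) (x : X), D (f • x) = f • D x := h
    simp [h']
  | succ s ih => exact fun f => ih (h f)

theorem IsDiffOp.sub {s : ℕ} {D D' : X → V} (h : IsDiffOp R s D) (h' : IsDiffOp R s D') :
    IsDiffOp R s fun x => D x - D' x := by
  induction s generalizing D D' with
  | zero =>
    intro f x
    change D (f • x) - D' (f • x) = _
    rw [h f x, h' f x, smul_sub]
  | succ s ih =>
    intro f
    convert ih (h f) (h' f) using 2
    rw [smul_sub, sub_sub_sub_comm]

theorem IsDiffOp.neg {s : ℕ} {D : X → V} (h : IsDiffOp R s D) : IsDiffOp R s fun x => -D x := by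
  induction s generalizing D with
  | zero =>
    intro f x
    change -D (f • x) = _
    rw [h f x, smul_neg]
  | succ s ih =>
    intro f
    convert ih (h f) using 2
    rw [smul_neg, neg_sub_neg, neg_sub]

end IsDiffOp

/-! ### The two components of the curvature and their symmetry. -/

namespace DorfmanConnection

variable {n : ℕ} {M : Type*} [TopologicalSpace M] [T2Space M]
  [ChartedSpace (EuclideanSpace ℝ (Fin n)) M] [IsManifold (𝓡 n) ∞ M]
  {FE : Type*} [NormedAddCommGroup FE] [NormedSpace ℝ FE] [FiniteDimensional ℝ FE]
  {E : M → Type*} [TopologicalSpace (TotalSpace FE E)] [∀ x, TopologicalSpace (E x)]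
  [∀ x, AddCommGroup (E x)] [∀ x, Module ℝ (E x)] [FiberBundle FE E] [VectorBundle ℝ FE E]
  [ContMDiffVectorBundle ∞ FE E (𝓡 n)]
  {C : CourantAlgebroid n FE E}
  {FB : Type*} [NormedAddCommGroup FB] [NormedSpace ℝ FB] [FiniteDimensional ℝ FB]
  {B : M → Type*} [TopologicalSpace (TotalSpace FB B)] [∀ x, TopologicalSpace (B x)]
  [∀ x, AddCommGroup (B x)] [∀ x, Module ℝ (B x)] [FiberBundle FB B] [VectorBundle ℝ FB B]
  [ContMDiffVectorBundle ∞ FB B (𝓡 n)]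
  {P : Predual C FB B} (N : DorfmanConnection P)

/-- The component `R_0(e₁, e₂)` of the curvature. -/
def curvatureSections (e₁ e₂ : SmoothSection n FE E) : EndSection n FB B where
  toFun b := N.nabla e₁ (N.nabla e₂ b) - N.nabla e₂ (N.nabla e₁ b) - N.nabla (C.bracket e₁ e₂) b
  map_add' b b' := by simp only [map_add]; abel
  map_smul' f b := by
    -- The second derivatives of `f` cancel because the anchor takes brackets to commutators of
    -- derivations.
    simp only [N.nabla_smul_right, map_add, C.anchorDeriv_bracket, RingHom.id_apply]
    module

/-- The component `R̄_1(α) = ∇_{ρ* α}` of the curvature on one-forms. -/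
def curvatureForm (α : OneForm n M) : EndSection n FB B where
  toFun b := N.nabla (C.rhoStar α) b
  map_add' b b' := by rw [map_add]
  map_smul' f b := by
    rw [N.nabla_smul_right, C.anchorDeriv_rhoStar, zero_smul, add_zero, RingHom.id_apply]

theorem curvatureSections_apply (e₁ e₂ : SmoothSection n FE E) (b : SmoothSection n FB B) :
    N.curvatureSections e₁ e₂ b =
      N.nabla e₁ (N.nabla e₂ b) - N.nabla e₂ (N.nabla e₁ b) - N.nabla (C.bracket e₁ e₂) b := rfl

theorem curvatureForm_apply (α : OneForm n M) (b : SmoothSection n FB B) :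
    N.curvatureForm α b = N.nabla (C.rhoStar α) b := rfl

theorem endNabla_apply (e : SmoothSection n FE E) (τ : EndSection n FB B)
    (b : SmoothSection n FB B) : N.endNabla e τ b = N.nabla e (τ b) - τ (N.nabla e b) := rfl

theorem curvature_sections (h : 2 + 2 * 0 = 2) (e : Fin 2 → SmoothSection n FE E)
    (f : Fin 0 → SmoothFun n M) :
    N.curvature 2 0 h e f = N.curvatureSections (e 0) (e 1) :=
  LinearMap.ext fun b => C.covDiff_covDiff_const_zero (fun e b => N.nabla e b) b h e f

theorem curvature_function (h : 0 + 2 * 1 = 2) (e : Fin 0 → SmoothSection n FE E)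
    (f : Fin 1 → SmoothFun n M) :
    N.curvature 0 1 h e f = N.curvatureForm (exteriorD (f 0)) :=
  LinearMap.ext fun b => C.covDiff_covDiff_const_one (fun e b => N.nabla e b) b h e f

/-- The commutator part is skew, so only `∇` along the symmetric part of the bracket survives. This
gives the swap condition on cochains and also reduces order in the first argument to order in the
second. -/
theorem curvatureSections_swap (e₁ e₂ : SmoothSection n FE E) :
    N.curvatureSections e₁ e₂ =
      -N.curvatureSections e₂ e₁ - N.curvatureForm (exteriorD (C.inner e₁ e₂)) := by
  ext1 b
  have h : N.nabla (C.rhoStar (exteriorD (C.inner e₁ e₂))) b =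
      N.nabla (C.bracket e₁ e₂) b + N.nabla (C.bracket e₂ e₁) b := by
    rw [← LinearMap.add_apply, ← map_add, C.bracket_add_bracket]
    rfl
  simp only [LinearMap.sub_apply, LinearMap.neg_apply, curvatureSections_apply,
    curvatureForm_apply, h]
  abel

theorem isLinearMap_curvatureSections_left (e : SmoothSection n FE E) :
    IsLinearMap ℝ fun s => N.curvatureSections s e where
  map_add s t := by
    ext1 b
    simp only [LinearMap.add_apply, curvatureSections_apply, map_add]
    abel
  map_smul c s := by
    ext1 b
    simp only [LinearMap.smul_apply, curvatureSections_apply, map_smul]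
    module

theorem isLinearMap_curvatureSections_right (e : SmoothSection n FE E) :
    IsLinearMap ℝ fun s => N.curvatureSections e s where
  map_add s t := by
    ext1 b
    simp only [LinearMap.add_apply, curvatureSections_apply, map_add]
    abel
  map_smul c s := by
    ext1 b
    simp only [LinearMap.smul_apply, curvatureSections_apply, map_smul]
    module

theorem isLinearMap_curvatureForm : IsLinearMap ℝ N.curvatureForm where
  map_add α β := by
    ext1 b
    simp only [LinearMap.add_apply, curvatureForm_apply, C.rhoStar_add, map_add]
  map_smul c α := by
    ext1 b
    simp only [LinearMap.smul_apply, curvatureForm_apply, C.rhoStar_smul, map_smul]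

/-! ### Orders of the curvature components. -/

theorem pairing_smul_left (f : SmoothFun n M) (e : SmoothSection n FE E)
    (b : SmoothSection n FB B) :
    pairSections P.pairing (f • e) b = f * pairSections P.pairing e b := by
  ext x; simp

theorem pairing_add_left (e e' : SmoothSection n FE E) (b : SmoothSection n FB B) :
    pairSections P.pairing (e + e') b =
      pairSections P.pairing e b + pairSections P.pairing e' b := by
  ext x; simp

/-- `d_B` is a derivation wherever the pairing does not vanish. -/
theorem pairing_smul_dB_mul (N : DorfmanConnection P) (e : SmoothSection n FE E)
    (b : SmoothSection n FB B) (f g : SmoothFun n M) :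
    pairSections P.pairing e b • P.dB (f * g) =
      pairSections P.pairing e b • (f • P.dB g + g • P.dB f) := by
  -- Expand `∇` along `(fg)e` once as a single product and once as `f(ge)`; the difference of the
  -- two expansions is the claim.
  have h₁ := N.nabla_smul_left (f * g) e b
  rw [mul_smul, N.nabla_smul_left, N.nabla_smul_left, pairing_smul_left] at h₁
  have h₂ := eq_sub_of_add_eq' h₁.symm
  rw [h₂]
  module

/-- The symbol at `f` sends `α` to `⟪ρ*α, b⟫ d_B f`, which is linear over functions in `α`. -/
theorem isDiffOp_curvatureForm : IsDiffOp (SmoothFun n M) 1 N.curvatureForm := by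
  intro f g α
  ext1 b
  simp only [LinearMap.sub_apply, LinearMap.smul_apply, curvatureForm_apply, C.rhoStar_fun_smul,
    N.nabla_smul_left, pairing_smul_left]
  module

/-- In the symbol at `f` the terms `ρ(e)(f) ∇_s b` and those with `d_B(ρ(e)(f))` cancel, leaving
`(ρ(e)⟪s, b⟫ - ⟪s, ∇_e b⟫ - ⟪⟦e, s⟧, b⟫) d_B f`. The coefficient is linear over functions in `s`,
since the derivative terms of its first and last summands agree. -/
theorem isDiffOp_curvatureSections_right (e : SmoothSection n FE E) :
    IsDiffOp (SmoothFun n M) 1 fun s => N.curvatureSections e s := by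
  intro f g s
  ext1 b
  simp only [LinearMap.sub_apply, LinearMap.smul_apply, curvatureSections_apply,
    C.bracket_smul_right, N.nabla_smul_left, N.nabla_smul_right, N.nabla_dB, pairing_smul_left,
    pairing_add_left, C.anchorDeriv_mul, map_add, LinearMap.add_apply]
  module

/-- Two derivatives fall on `s`: one through `d_E⟨s, e⟩`, one through the failure of `∇` to be
linear over functions in its first slot. -/
theorem isDiffOp_curvatureForm_inner (e : SmoothSection n FE E) :
    IsDiffOp (SmoothFun n M) 2 fun s => N.curvatureForm (exteriorD (C.inner s e)) := by
  -- The first symbol: the middle term is already of order 0 in `s`, the outer two are of order 1.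
  have hs : ∀ (f : SmoothFun n M) (s : SmoothSection n FE E) (b : SmoothSection n FB B),
      N.curvatureForm (exteriorD (C.inner (f • s) e)) b
          - f • N.curvatureForm (exteriorD (C.inner s e)) b =
        pairSections P.pairing (C.dE (C.inner s e)) b • P.dB f
          + C.inner s e • N.nabla (C.dE f) b
          + pairSections P.pairing (C.dE f) b • P.dB (C.inner s e) := by
    intro f s b
    change N.nabla (C.dE (C.inner (f • s) e)) b - f • N.nabla (C.dE (C.inner s e)) b = _
    rw [C.inner_smul_left, C.dE_mul, map_add, LinearMap.add_apply, N.nabla_smul_left,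
      N.nabla_smul_left]
    module
  intro f g h s
  ext1 b
  simp only [LinearMap.sub_apply, LinearMap.smul_apply, hs]
  simp only [C.inner_smul_left, C.dE_mul, pairing_add_left, pairing_smul_left,
    N.pairing_smul_dB_mul]
  -- Splitting `d_B` of the triple product leaves `d_B(h⟨s, e⟩)` under an extra factor `g`, so the
  -- weak derivation rule is needed once more, multiplied by `g`.
  linear_combination (norm := module) g • N.pairing_smul_dB_mul (C.dE f) b h (C.inner s e)

/-- After a swap, `s` sits in the last slot, of order 1, at the cost of the correction term, which
alone accounts for order 2. -/
theorem isDiffOp_curvatureSections_left (e : SmoothSection n FE E) :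
    IsDiffOp (SmoothFun n M) 2 fun s => N.curvatureSections s e := by
  simp only [fun s => N.curvatureSections_swap s e]
  exact (N.isDiffOp_curvatureSections_right e).succ.neg.sub (N.isDiffOp_curvatureForm_inner e)

/-! ### Membership in the space of cochains of differential operators. -/

/-- The realisation of the curvature on sections and one-forms. -/
def curvatureCochain : Cochain (SmoothSection n FE E) (OneForm n M) (EndSection n FB B) 2
  | 2, 0, _, e, _ => N.curvatureSections (e 0) (e 1)
  | 0, 1, _, _, α => N.curvatureForm (α 0)
  -- Never reached: `q + 2k = 2` leaves only the two pairs above.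
  | _, _, _, _, _ => 0

theorem isDiffCochain_curvatureCochain : C.IsDiffCochain 2 N.curvatureCochain where
  linear_section q k h e α i := by
    obtain ⟨rfl, rfl⟩ | ⟨rfl, rfl⟩ : (q = 2 ∧ k = 0) ∨ (q = 0 ∧ k = 1) := by omega
    · fin_cases i
      · simpa [curvatureCochain] using N.isLinearMap_curvatureSections_left (e 1)
      · simpa [curvatureCochain] using N.isLinearMap_curvatureSections_right (e 0)
    · exact i.elim0
  linear_form q k h e α μ := by
    obtain ⟨rfl, rfl⟩ | ⟨rfl, rfl⟩ : (q = 2 ∧ k = 0) ∨ (q = 0 ∧ k = 1) := by omega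
    · exact μ.elim0
    · fin_cases μ
      simpa [curvatureCochain] using N.isLinearMap_curvatureForm
  symm_form q k h e α σ := by
    -- At most one form occurs, so the only permutation is the identity.
    have : Subsingleton (Fin k) := Fin.subsingleton_iff_le_one.2 (by omega)
    rw [Subsingleton.elim σ 1]
    rfl
  swap_section q k h e α i := by
    obtain ⟨rfl, rfl⟩ : q = 0 ∧ k = 0 := by omega
    fin_cases i
    change N.curvatureSections (e 0) (e 1) + N.curvatureSections (e 1) (e 0) =
      -N.curvatureForm (exteriorD (C.inner (e 0) (e 1)))
    rw [N.curvatureSections_swap (e 0) (e 1)]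
    abel
  order_form q k h e α μ := by
    obtain ⟨rfl, rfl⟩ | ⟨rfl, rfl⟩ : (q = 2 ∧ k = 0) ∨ (q = 0 ∧ k = 1) := by omega
    · exact μ.elim0
    · fin_cases μ
      simpa [curvatureCochain] using N.isDiffOp_curvatureForm.succ
  order_section q k h e α i := by
    obtain ⟨rfl, rfl⟩ | ⟨rfl, rfl⟩ : (q = 2 ∧ k = 0) ∨ (q = 0 ∧ k = 1) := by omega
    · fin_cases i
      · simpa [curvatureCochain] using N.isDiffOp_curvatureSections_left (e 1)
      · simpa [curvatureCochain] using N.isDiffOp_curvatureSections_right (e 0)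
    · exact i.elim0

theorem memDiffCochain_curvature : C.MemDiffCochain 2 N.curvature := by
  refine ⟨N.curvatureCochain, N.isDiffCochain_curvatureCochain, fun q k h e f => ?_⟩
  obtain ⟨rfl, rfl⟩ | ⟨rfl, rfl⟩ : (q = 2 ∧ k = 0) ∨ (q = 0 ∧ k = 1) := by omega
  · exact N.curvature_sections h e f
  · exact N.curvature_function h e f

/-! ### The Bianchi identity. -/

/-- Once the Jacobi identity rewrites the bracket of `e₁` with that of `e₂` and `e₃`, what remains
is an identity between compositions of operators in an additive group. -/
theorem bianchi_sections (e₁ e₂ e₃ : SmoothSection n FE E) :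
    N.endNabla e₁ (N.curvatureSections e₂ e₃) - N.endNabla e₂ (N.curvatureSections e₁ e₃)
      + N.endNabla e₃ (N.curvatureSections e₁ e₂)
      - N.curvatureSections (C.bracket e₁ e₂) e₃ - N.curvatureSections e₂ (C.bracket e₁ e₃)
      + N.curvatureSections e₁ (C.bracket e₂ e₃) = 0 := by
  ext1 b
  simp only [LinearMap.add_apply, LinearMap.sub_apply, endNabla_apply, curvatureSections_apply,
    map_sub, C.jacobi e₁ e₂ e₃, map_add, LinearMap.zero_apply]
  abel

/-- Both summands are commutators of `∇_{d_E f}` and `∇_e`, with opposite signs, up to the bracket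
term that `bracket_dE` removes. -/
theorem bianchi_function (e : SmoothSection n FE E) (f : SmoothFun n M) :
    N.curvatureSections (C.dE f) e + N.endNabla e (N.curvatureForm (exteriorD f)) = 0 := by
  ext1 b
  change N.nabla (C.dE f) (N.nabla e b) - N.nabla e (N.nabla (C.dE f) b)
    - N.nabla (C.bracket (C.dE f) e) b
    + (N.nabla e (N.nabla (C.dE f) b) - N.nabla (C.dE f) (N.nabla e b)) = 0
  rw [C.bracket_dE, map_zero, LinearMap.zero_apply]
  abel

theorem dEndNabla_curvature (q k : ℕ) (h : q + 2 * k = 2 + 1) (e : Fin q → SmoothSection n FE E)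
    (f : Fin k → SmoothFun n M) : N.dEndNabla N.curvature q k h e f = 0 := by
  obtain ⟨rfl, rfl⟩ | ⟨rfl, rfl⟩ : (q = 3 ∧ k = 0) ∨ (q = 1 ∧ k = 1) := by omega
  · rw [← N.bianchi_sections (e 0) (e 1) (e 2)]
    simp [dEndNabla, CourantAlgebroid.covDiff, CourantAlgebroid.diffTermFun,
      CourantAlgebroid.diffTermNabla, CourantAlgebroid.diffTermBracket, Fin.sum_univ_three,
      curvature_sections, Fin.removeNth, Fin.succAbove, Function.update]
    abel
  -- With a single section the bracket sum over `i < j` is empty.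
  · rw [← N.bianchi_function (e 0) (f 0)]
    simp [dEndNabla, CourantAlgebroid.covDiff, CourantAlgebroid.diffTermFun,
      CourantAlgebroid.diffTermNabla, CourantAlgebroid.diffTermBracket,
      curvature_sections, curvature_function]

end DorfmanConnection

end

theorem mainTheorem5 {n : ℕ}
    {M : Type*} [TopologicalSpace M] [T2Space M] [SecondCountableTopology M]
    [ChartedSpace (EuclideanSpace ℝ (Fin n)) M] [IsManifold (𝓡 n) ∞ M]
    {FE : Type*} [NormedAddCommGroup FE] [NormedSpace ℝ FE] [FiniteDimensional ℝ FE]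
    {E : M → Type*} [TopologicalSpace (TotalSpace FE E)] [∀ x, TopologicalSpace (E x)]
    [∀ x, AddCommGroup (E x)] [∀ x, Module ℝ (E x)] [FiberBundle FE E] [VectorBundle ℝ FE E]
    [ContMDiffVectorBundle ∞ FE E (𝓡 n)]
    {FB : Type*} [NormedAddCommGroup FB] [NormedSpace ℝ FB] [FiniteDimensional ℝ FB]
    {B : M → Type*} [TopologicalSpace (TotalSpace FB B)] [∀ x, TopologicalSpace (B x)]
    [∀ x, AddCommGroup (B x)] [∀ x, Module ℝ (B x)] [FiberBundle FB B] [VectorBundle ℝ FB B]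
    [ContMDiffVectorBundle ∞ FB B (𝓡 n)]
    {C : CourantAlgebroid n FE E} {P : Predual C FB B} (N : DorfmanConnection P) :
    C.MemDiffCochain 2 N.curvature ∧
      ∀ (q k : ℕ) (h : q + 2 * k = 2 + 1) (e : Fin q → SmoothSection n FE E)
        (f : Fin k → SmoothFun n M), N.dEndNabla N.curvature q k h e f = 0 :=
  ⟨N.memDiffCochain_curvature, N.dEndNabla_curvature⟩
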